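/- Theorem (Hilbert's syzygy theorem for a PID). Let $R$ be a principal ideal domain, let $n \ge 0$ be an integer, and let $S = R[x_1,\dots,x_n]$. Then every finitely generated $S$-module $M$ admits a finite free resolution of length at most $n+1$: there are an integer $p$ with $0 \le p \le n+1$, finitely generated free $S$-modules $F_0,\dots,F_p$, and an exact sequence of $S$-modules $$0 \to F_p \to F_{p-1} \to \cdots \to F_1 \to F_0 \to M \to 0 .$$ -/

import Mathlib

/-- A resolution of an `S`-module `M` of length (at most) `p` by finitely generated free modules
`F i = S ^ rank i`: an exact sequence `0 → F p → ⋯ → F 1 → F 0 → M → 0` of `S`-modules.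
The terms with index greater than `p` are the zero module `S ^ 0`, so exactness at `F p` is the
injectivity of `F p → F (p - 1)` (of `F 0 → M` if `p = 0`). -/
structure FiniteFreeResolution (S : Type*) [CommRing S] (M : Type*) [AddCommGroup M] [Module S M]
    (p : ℕ) where
  /-- the rank of the `i`-th free module -/
  rank : ℕ → ℕ
  /-- the free modules vanish in degrees greater than `p` -/
  rank_eq_zero : ∀ i, p < i → rank i = 0
  /-- the differential `F (i + 1) → F i` -/
  d : ∀ i, (Fin (rank (i + 1)) → S) →ₗ[S] (Fin (rank i) → S)
  /-- the augmentation `F 0 → M` -/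
  augmentation : (Fin (rank 0) → S) →ₗ[S] M
  /-- exactness at `M` -/
  augmentation_surjective : Function.Surjective augmentation
  /-- exactness at `F 0` -/
  exact_zero : Function.Exact (d 0) augmentation
  /-- exactness at `F (i + 1)` -/
  exact_succ : ∀ i, Function.Exact (d (i + 1)) (d i)

/-! Induct on the number of variables: if finite modules over a Noetherian ring `A` have finite free
resolutions of length `d`, those over `A[X]` have ones of length `d + 1`. Given `M` over `A[X]` with
generators `e j` and finitely many relations of degree at most `d`, let `L k` be the `A`-span of the
`X ^ c • e j` with `c < k`. Then `0 → A[X] ⊗ L d → A[X] ⊗ L (d + 1) → M → 0` is exact, the first map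
being `X ⊗ i - 1 ⊗ x` with `i` the inclusion and `x` multiplication by `X`
(`exists_exact_characteristicMap`). Resolutions of the two `A`-modules extend to `A[X]` by flatness,
and `of_quotient` combines them. All terms stay free, so projective modules over polynomial rings
never need to be shown free. -/

open scoped TensorProduct Polynomial

universe u

/-! ### Modules with finite free resolutions of bounded length -/

/-- `M` has a resolution of length at most `d` by finitely generated free modules, as a recursive
condition: `M` is finite free if `d = 0`, and some presentation of `M` by a finite free module has
a kernel satisfying the condition for `d - 1` otherwise. -/
def FreeDimLE (S : Type u) [CommRing S] :
    ℕ → ∀ (M : Type u) [AddCommGroup M] [Module S M], Prop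
  | 0, M, _, _ => Module.Free S M ∧ Module.Finite S M
  | d + 1, M, _, _ => ∃ (r : ℕ) (f : (Fin r → S) →ₗ[S] M),
      Function.Surjective f ∧ FreeDimLE S d (LinearMap.ker f)

theorem Module.Free.exists_equiv_fin (S : Type*) [CommRing S] (M : Type*) [AddCommGroup M]
    [Module S M] [Module.Free S M] [Module.Finite S M] :
    ∃ r : ℕ, Nonempty ((Fin r → S) ≃ₗ[S] M) :=
  ⟨_, ⟨(((Module.Free.chooseBasis S M).reindex (Fintype.equivFin _)).equivFun).symm⟩⟩

namespace FreeDimLE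

section

variable {S : Type u} [CommRing S] {M N P : Type u} [AddCommGroup M] [Module S M]
  [AddCommGroup N] [Module S N] [AddCommGroup P] [Module S P]

theorem of_equiv {d : ℕ} (h : FreeDimLE S d M) (e : M ≃ₗ[S] N) : FreeDimLE S d N := by
  cases d with
  | zero =>
    obtain ⟨h₁, h₂⟩ := h
    exact ⟨Module.Free.of_equiv e, Module.Finite.equiv e⟩
  | succ d =>
    obtain ⟨r, f, hf, h⟩ := h
    refine ⟨r, e.toLinearMap ∘ₗ f, e.surjective.comp hf, ?_⟩
    rwa [LinearEquiv.ker_comp]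

theorem of_ker {d : ℕ} {F : Type u} [AddCommGroup F] [Module S F] [Module.Free S F]
    [Module.Finite S F] (f : F →ₗ[S] M) (hf : Function.Surjective f)
    (h : FreeDimLE S d (LinearMap.ker f)) : FreeDimLE S (d + 1) M := by
  obtain ⟨r, ⟨e⟩⟩ := Module.Free.exists_equiv_fin S F
  refine ⟨r, f ∘ₗ e.toLinearMap, hf.comp e.surjective, ?_⟩
  rw [LinearMap.ker_comp]
  exact h.of_equiv (LinearEquiv.ofSubmodule' e _).symm

theorem of_subsingleton [Subsingleton M] (d : ℕ) : FreeDimLE S d M := by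
  induction d generalizing M with
  | zero => exact ⟨inferInstance, inferInstance⟩
  | succ d ih => exact of_ker (LinearMap.id : M →ₗ[S] M) Function.surjective_id ih

theorem succ {d : ℕ} (h : FreeDimLE S d M) : FreeDimLE S (d + 1) M := by
  induction d generalizing M with
  | zero =>
    obtain ⟨h₁, h₂⟩ := h
    refine of_ker (LinearMap.id : M →ₗ[S] M) Function.surjective_id ?_
    rw [LinearMap.ker_id]
    exact of_subsingleton 0
  | succ d ih =>
    obtain ⟨r, f, hf, h⟩ := h
    exact ⟨r, f, hf, ih h⟩

/-- The condition is stable under extensions. -/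
theorem of_extension {d : ℕ} (f : M →ₗ[S] N) (g : N →ₗ[S] P) (hf : Function.Injective f)
    (hg : Function.Surjective g) (hfg : Function.Exact f g) (hM : FreeDimLE S d M)
    (hP : FreeDimLE S d P) : FreeDimLE S d N := by
  induction d generalizing M N P with
  | zero =>
    obtain ⟨_, _⟩ := hM
    obtain ⟨_, _⟩ := hP
    obtain ⟨l, hl⟩ := Module.projective_lifting_property g LinearMap.id hg
    let e := (hfg.splitSurjectiveEquiv hf ⟨l, hl⟩).1
    exact ⟨Module.Free.of_equiv e.symm, Module.Finite.equiv e.symm⟩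
  | succ d ih =>
    obtain ⟨r, p, hp, hM⟩ := hM
    obtain ⟨s, q, hq, hP⟩ := hP
    obtain ⟨l, hl⟩ := Module.projective_lifting_property g q hg
    have hl' (y) : g (l y) = q y := LinearMap.congr_fun hl y
    -- Horseshoe lemma: `φ` covers `N`, and its kernel is an extension of `ker q` by `ker p`.
    let φ : (Fin r → S) × (Fin s → S) →ₗ[S] N := (f ∘ₗ p).coprod l
    have hφ (x y) : φ (x, y) = f (p x) + l y := rfl
    have hgφ (z) : g (φ z) = q z.2 := by
      rw [hφ, map_add, hfg.apply_apply_eq_zero, zero_add, hl']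
    refine of_ker φ (fun n => ?_) (ih (M := LinearMap.ker p) (P := LinearMap.ker q)
      ((LinearMap.inl S _ _).restrict (fun x (hx : p x = 0) => ?_))
      ((LinearMap.snd S _ _).restrict (fun z (hz : φ z = 0) => ?_))
      ?_ ?_ ?_ hM hP)
    · obtain ⟨y, hy⟩ := hq (g n)
      obtain ⟨m, hm⟩ := (hfg (n - l y)).1 (by rw [map_sub, hl', hy, sub_self])
      obtain ⟨x, rfl⟩ := hp m
      exact ⟨(x, y), by rw [hφ, hm, sub_add_cancel]⟩
    · rw [LinearMap.mem_ker, LinearMap.inl_apply, hφ, hx, map_zero, map_zero, add_zero]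
    · rw [LinearMap.mem_ker, LinearMap.snd_apply, ← hgφ, hz, map_zero]
    · rintro ⟨x, hx⟩ ⟨y, hy⟩ hxy
      exact Subtype.ext (congrArg (fun z => z.1.1) hxy)
    · rintro ⟨y, hy⟩
      obtain ⟨m, hm⟩ := (hfg (l y)).1 (by rw [hl', hy])
      obtain ⟨x, rfl⟩ := hp m
      refine ⟨⟨(-x, y), ?_⟩, rfl⟩
      rw [LinearMap.mem_ker, hφ, map_neg, map_neg, hm, neg_add_cancel]
    · rintro ⟨⟨x, y⟩, hz⟩
      constructor
      · intro h
        obtain rfl : y = 0 := congrArg Subtype.val h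
        refine ⟨⟨x, hf ?_⟩, rfl⟩
        rw [LinearMap.mem_ker, hφ] at hz
        simpa using hz
      · rintro ⟨w, hw⟩
        exact Subtype.ext (congrArg (fun z => z.1.2) hw).symm

/-- The quotient of a module satisfying the condition by a submodule satisfying it satisfies the
condition with the bound increased by one. -/
theorem of_quotient {d : ℕ} (f : M →ₗ[S] N) (g : N →ₗ[S] P) (hf : Function.Injective f)
    (hg : Function.Surjective g) (hfg : Function.Exact f g) (hM : FreeDimLE S d M)
    (hN : FreeDimLE S d N) : FreeDimLE S (d + 1) P := by
  -- Raising the bound on `N` gives a cover `p` with `ker p` of bound `d`, even if `d = 0`. The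
  -- kernel of `g ∘ p` is then an extension of `ker g ≅ M` by `ker p`.
  obtain ⟨r, p, hp, hN⟩ := hN.succ
  have hker : FreeDimLE S d (LinearMap.ker g) := by
    rw [hfg.linearMap_ker_eq]
    exact hM.of_equiv (LinearEquiv.ofInjective f hf)
  refine ⟨r, g ∘ₗ p, hg.comp hp, of_extension (M := LinearMap.ker p) (P := LinearMap.ker g)
    (Submodule.inclusion (LinearMap.ker_le_ker_comp p g)) (p.restrict fun x hx => hx)
    (Submodule.inclusion_injective _) ?_ ?_ hN hker⟩
  · rintro ⟨y, hy⟩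
    obtain ⟨x, rfl⟩ := hp y
    exact ⟨⟨x, hy⟩, rfl⟩
  · rintro ⟨x, hx⟩
    constructor
    · intro h
      exact ⟨⟨x, congrArg Subtype.val h⟩, rfl⟩
    · rintro ⟨w, hw⟩
      have : w.1 = x := congrArg Subtype.val hw
      exact Subtype.ext (this ▸ w.2)

end

/-- By flatness, tensoring with `B` commutes with taking kernels. -/
theorem baseChange {A : Type u} [CommRing A] (B : Type u) [CommRing B] [Algebra A B]
    [Module.Flat A B] {d : ℕ} {M : Type u} [AddCommGroup M] [Module A M]
    (h : FreeDimLE A d M) : FreeDimLE B d (B ⊗[A] M) := by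
  induction d generalizing M with
  | zero =>
    obtain ⟨_, _⟩ := h
    exact ⟨inferInstance, inferInstance⟩
  | succ d ih =>
    obtain ⟨r, f, hf, h⟩ := h
    exact of_ker (TensorProduct.AlgebraTensorModule.lTensor B B f)
      (LinearMap.lTensor_surjective B hf)
      ((ih h).of_equiv (LinearMap.tensorKerEquiv B B f))

/-- Submodules of finite free modules over a PID are finite free, so the first kernel is already
free. -/
theorem of_isPrincipalIdealRing {R : Type u} [CommRing R] [IsDomain R] [IsPrincipalIdealRing R]
    (M : Type u) [AddCommGroup M] [Module R M] [Module.Finite R M] : FreeDimLE R 1 M := by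
  obtain ⟨r, f, hf⟩ := Module.Finite.exists_fin' R M
  exact ⟨r, f, hf, inferInstance, inferInstance⟩

/-- The condition for all finite modules passes to isomorphic rings. -/
theorem of_ringEquiv {A B : Type u} [CommRing A] [CommRing B] (e : A ≃+* B) {d : ℕ}
    (h : ∀ (M : Type u) [AddCommGroup M] [Module A M] [Module.Finite A M], FreeDimLE A d M)
    (M : Type u) [AddCommGroup M] [Module B M] [Module.Finite B M] : FreeDimLE B d M := by
  let := e.toRingHom.toAlgebra
  let := Module.compHom M (algebraMap A B)
  have he : Function.Bijective (algebraMap A B) := e.bijective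
  have : IsScalarTower A B M := ⟨fun a b m => by
    rw [Algebra.smul_def, mul_smul]; rfl⟩
  let e' : A ≃ₗ[A] B := LinearEquiv.ofBijective (Algebra.linearMap A B) he
  have : Module.Finite A B := Module.Finite.equiv e'
  have : Module.Finite A M := Module.Finite.trans B M
  have : Module.Flat A B := Module.Flat.of_linearEquiv e'.symm
  -- As `A ≃ B`, extending scalars to `B` gives back `M`.
  let f : B ⊗[A] M →ₗ[B] M := LinearMap.liftBaseChange B LinearMap.id
  have hf (m : M) : f (1 ⊗ₜ m) = m := by simp [f]
  have hsurj (z : B ⊗[A] M) : ∃ m : M, 1 ⊗ₜ m = z := by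
    induction z with
    | zero => exact ⟨0, TensorProduct.tmul_zero _ _⟩
    | tmul b m =>
      obtain ⟨a, rfl⟩ := he.2 b
      exact ⟨a • m, by rw [← TensorProduct.smul_tmul, Algebra.algebraMap_eq_smul_one]⟩
    | add y z hy hz =>
      obtain ⟨m, rfl⟩ := hy
      obtain ⟨n, rfl⟩ := hz
      exact ⟨m + n, TensorProduct.tmul_add _ _ _⟩
  refine ((h M).baseChange B).of_equiv (LinearEquiv.ofBijective f ⟨?_, fun m => ⟨_, hf m⟩⟩)
  intro y z hyz
  obtain ⟨m, rfl⟩ := hsurj y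
  obtain ⟨n, rfl⟩ := hsurj z
  rw [hf, hf] at hyz
  rw [hyz]

end FreeDimLE

/-! ### The map `X ⊗ i - 1 ⊗ x` -/

namespace Polynomial

variable {A : Type*} [CommRing A] {N N' : Type*} [AddCommGroup N] [Module A N]
  [AddCommGroup N'] [Module A N']

/-- The `A[X]`-linear map `X ⊗ i - 1 ⊗ x` attached to two `A`-linear maps `i` and `x`. -/
noncomputable def characteristicMap (i x : N' →ₗ[A] N) : A[X] ⊗[A] N' →ₗ[A[X]] A[X] ⊗[A] N :=
  (X : A[X]) • i.baseChange A[X] - x.baseChange A[X]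

theorem characteristicMap_tmul (i x : N' →ₗ[A] N) (b : A[X]) (n : N') :
    characteristicMap i x (b ⊗ₜ n) = (X * b) ⊗ₜ i n - b ⊗ₜ x n := by
  simp [characteristicMap, TensorProduct.smul_tmul']

/-- Compare coefficients: the image of `∑ X ^ k ⊗ t k` has `i (t k) - x (t (k + 1))` in degree `k +
1`. If it vanishes, `t (k + 1) = 0` forces `t k = 0`, and one descends from beyond the degree. -/
theorem characteristicMap_injective (i x : N' →ₗ[A] N) (hi : Function.Injective i) :
    Function.Injective (characteristicMap i x) := by
  let E := TensorProduct.equivFinsuppOfBasisLeft (N := N') (Polynomial.basisMonomials A)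
  let F := TensorProduct.equivFinsuppOfBasisLeft (N := N) (Polynomial.basisMonomials A)
  have hE (b : A[X]) (n : N') (k : ℕ) : E (b ⊗ₜ n) k = b.coeff k • n :=
    TensorProduct.equivFinsuppOfBasisLeft_apply_tmul_apply _ _ _ _
  have hF (b : A[X]) (n : N) (k : ℕ) : F (b ⊗ₜ n) k = b.coeff k • n :=
    TensorProduct.equivFinsuppOfBasisLeft_apply_tmul_apply _ _ _ _
  have key (t : A[X] ⊗[A] N') (k : ℕ) :
      F (characteristicMap i x t) (k + 1) = i (E t k) - x (E t (k + 1)) := by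
    induction t with
    | zero => simp
    | tmul b n =>
      rw [characteristicMap_tmul, map_sub, Finsupp.sub_apply, hE, hE, hF, hF, coeff_X_mul,
        map_smul, map_smul]
    | add y z hy hz =>
      simp only [map_add, Finsupp.add_apply, hy, hz]
      abel
  rw [← LinearMap.ker_eq_bot, LinearMap.ker_eq_bot']
  intro t ht
  have step (k : ℕ) (hk : E t (k + 1) = 0) : E t k = 0 := by
    have := key t k
    rw [ht, hk, map_zero, map_zero, sub_zero, Finsupp.zero_apply] at this
    exact hi (this.symm.trans (map_zero i).symm)
  have descend (j k : ℕ) (hk : E t (k + j) = 0) : E t k = 0 := by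
    induction j with
    | zero => exact hk
    | succ j ih => exact ih (step _ hk)
  rw [← E.map_eq_zero_iff]
  ext k
  refine descend ((E t).support.sup id + 1) k ?_
  by_contra hne
  have := Finset.le_sup (f := id) (Finsupp.mem_support_iff.2 hne)
  simp only [id] at this
  omega

end Polynomial

/-! ### Two-term resolutions over `A[X]` -/

open Polynomial

/-- A finite module over `A[X]`, with `A` Noetherian, has a two-term resolution by modules
extended from finite `A`-modules. -/
theorem exists_exact_characteristicMap (A : Type u) [CommRing A] [IsNoetherianRing A]
    (M : Type u) [AddCommGroup M] [Module A M] [Module A[X] M] [IsScalarTower A A[X] M]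
    [Module.Finite A[X] M] :
    ∃ (N' N : Submodule A M) (i x : N' →ₗ[A] N), Module.Finite A N' ∧ Module.Finite A N ∧
      Function.Injective i ∧
      Function.Surjective (LinearMap.liftBaseChange A[X] N.subtype) ∧
      Function.Exact (characteristicMap i x) (LinearMap.liftBaseChange A[X] N.subtype) := by
  obtain ⟨r, π, hπ⟩ := Module.Finite.exists_fin' A[X] M
  let e (j : Fin r) : M := π (Pi.single j 1)
  let L (k : ℕ) : Submodule A M :=
    Submodule.span A (Set.range fun p : Fin k × Fin r => (X ^ (p.1 : ℕ) : A[X]) • e p.2)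
  have hL (k : ℕ) (c : ℕ) (hc : c < k) (j : Fin r) : (X ^ c : A[X]) • e j ∈ L k :=
    Submodule.subset_span ⟨(⟨c, hc⟩, j), rfl⟩
  have hfin (k : ℕ) : Module.Finite A (L k) :=
    Module.Finite.span_of_finite A (Set.finite_range _)
  obtain ⟨s, hs⟩ := IsNoetherian.noetherian (LinearMap.ker π)
  -- `d` bounds the degrees in a finite generating set of relations, so every term of such a
  -- relation maps into `L (d + 1)`.
  let d : ℕ := s.sup fun v => Finset.univ.sup fun j => (v j).natDegree
  have hd (v) (hv : v ∈ s) (j) : (v j).natDegree ≤ d :=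
    (Finset.le_sup (f := fun j => (v j).natDegree) (Finset.mem_univ j)).trans
      (Finset.le_sup (f := fun v : Fin r → A[X] => Finset.univ.sup fun j => (v j).natDegree) hv)
  have hle : L d ≤ L (d + 1) := by
    rw [Submodule.span_le]
    rintro _ ⟨⟨c, j⟩, rfl⟩
    exact hL _ _ (by omega) _
  have hX (m : M) (hm : m ∈ L d) : (X : A[X]) • m ∈ L (d + 1) := by
    induction hm using Submodule.span_induction with
    | mem _ h =>
      obtain ⟨⟨c, j⟩, rfl⟩ := h
      rw [smul_smul, ← pow_succ']
      exact hL _ _ (by omega) _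
    | zero => rw [smul_zero]; exact zero_mem _
    | add y z _ _ hy hz => rw [smul_add]; exact add_mem hy hz
    | smul a y _ hy => rw [smul_comm]; exact Submodule.smul_mem _ _ hy
  let i : L d →ₗ[A] L (d + 1) := Submodule.inclusion hle
  let x : L d →ₗ[A] L (d + 1) :=
    (Algebra.lsmul A A M (X : A[X])).restrict hX
  let g : A[X] ⊗[A] L (d + 1) →ₗ[A[X]] M := LinearMap.liftBaseChange A[X] (L (d + 1)).subtype
  have hg (b : A[X]) (n : L (d + 1)) : g (b ⊗ₜ n) = b • (n : M) := by simp [g]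
  have hgf (t) : g (characteristicMap i x t) = 0 := by
    induction t with
    | zero => simp
    | tmul b n =>
      rw [characteristicMap_tmul, map_sub, hg, hg, sub_eq_zero, mul_comm, mul_smul]
      rfl
    | add y z hy hz => rw [map_add, map_add, hy, hz, add_zero]
  -- It remains to see that `g` is injective on the cokernel `Q`. For this, `Q` is compared with the
  -- presentation `π` through `ψ`, which sends the basis to the classes of `1 ⊗ e j`.
  let Q := (A[X] ⊗[A] L (d + 1)) ⧸ LinearMap.range (characteristicMap i x)
  let q : A[X] ⊗[A] L (d + 1) →ₗ[A[X]] Q := Submodule.mkQ _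
  have hq (n : L d) : q (1 ⊗ₜ x n) = (X : A[X]) • q (1 ⊗ₜ i n) := by
    rw [← map_smul, ← sub_eq_zero, ← map_sub, ← neg_eq_zero, ← map_neg, neg_sub,
      TensorProduct.smul_tmul', smul_eq_mul, ← characteristicMap_tmul]
    exact (Submodule.Quotient.mk_eq_zero _).2 ⟨_, rfl⟩
  have hpow (c : ℕ) (j : Fin r) (hc : c < d + 1) :
      q (1 ⊗ₜ ⟨_, hL _ c hc j⟩) =
        (X ^ c : A[X]) • q (1 ⊗ₜ ⟨_, hL _ 0 d.succ_pos j⟩) := by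
    induction c with
    | zero => exact ((congrArg (· • _) (pow_zero X)).trans (one_smul _ _)).symm
    | succ c ih =>
      have hx : x ⟨_, hL d c (by omega) j⟩ = ⟨_, hL _ (c + 1) hc j⟩ :=
        Subtype.ext ((smul_smul _ _ _).trans (congrArg (· • e j) (pow_succ' X c).symm))
      refine (congrArg (fun n => q (1 ⊗ₜ n)) hx.symm).trans ((hq _).trans ?_)
      refine (congrArg ((X : A[X]) • ·) (ih (by omega))).trans ?_
      rw [smul_smul]
      exact congrArg (· • _) (pow_succ' X c).symm
  let ψ : (Fin r → A[X]) →ₗ[A[X]] Q :=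
    Fintype.linearCombination A[X] fun j => q (1 ⊗ₜ ⟨_, hL _ 0 d.succ_pos j⟩)
  have hψ (j) (b : A[X]) :
      ψ (Pi.single j b) = b • q (1 ⊗ₜ ⟨_, hL _ 0 d.succ_pos j⟩) := by
    simp [ψ]
  have hπs (j) (b : A[X]) : π (Pi.single j b) = b • e j := by
    rw [← map_smul, ← Pi.single_smul, smul_eq_mul, mul_one]
  have hdeg (j) (b : A[X]) (hb : b.natDegree ≤ d) :
      ∃ n : L (d + 1), π (Pi.single j b) = n ∧ ψ (Pi.single j b) = q (1 ⊗ₜ n) := by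
    refine ⟨∑ c : Fin (d + 1), b.coeff c • ⟨_, hL _ c c.2 j⟩, ?_, ?_⟩
    · rw [hπs]
      conv_lhs => rw [b.as_sum_range_C_mul_X_pow' (Nat.lt_succ_of_le hb), Finset.sum_smul,
        ← Fin.sum_univ_eq_sum_range (fun c => (C (b.coeff c) * X ^ c) • e j)]
      simp [← Polynomial.smul_eq_C_mul]
    · rw [hψ]
      conv_lhs => rw [b.as_sum_range_C_mul_X_pow' (Nat.lt_succ_of_le hb), Finset.sum_smul,
        ← Fin.sum_univ_eq_sum_range
          (fun c => (C (b.coeff c) * X ^ c) • q (1 ⊗ₜ ⟨_, hL _ 0 d.succ_pos j⟩))]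
      rw [TensorProduct.tmul_sum, map_sum]
      refine Finset.sum_congr rfl fun c _ => ?_
      rw [TensorProduct.tmul_smul, mul_smul, ← hpow c j c.2, ← Polynomial.algebraMap_eq,
        algebraMap_smul, LinearMap.map_smul_of_tower]
  -- For a generating relation `v`, `hdeg` gives `ψ v = q (1 ⊗ n)` where `n = π v = 0` in `L (d +
  -- 1)`.
  have hker (v) (hv : π v = 0) : ψ v = 0 := by
    suffices LinearMap.ker π ≤ LinearMap.ker ψ from this hv
    rw [← hs, Submodule.span_le]
    intro v hv
    have hv0 : π v = 0 := by
      rw [← LinearMap.mem_ker, ← hs]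
      exact Submodule.subset_span hv
    choose n hn hn' using fun j => hdeg j (v j) (hd v hv j)
    have hv' : v = ∑ j, Pi.single j (v j) := (Finset.univ_sum_single v).symm
    have h0 : ∑ j, n j = 0 := Subtype.ext (by
      rw [hv', map_sum] at hv0
      simpa [hn] using hv0)
    change ψ v = 0
    rw [hv', map_sum, Finset.sum_congr rfl fun j _ => hn' j, ← map_sum, ← TensorProduct.tmul_sum,
      h0, TensorProduct.tmul_zero, map_zero]
  -- With `hker`, this gives exactness: `g t = 0` means `π v = 0`, so `q t = ψ v = 0`.
  have hlift (t) : ∃ v, ψ v = q t ∧ π v = g t := by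
    induction t with
    | zero => exact ⟨0, by simp, by simp⟩
    | tmul b n =>
      obtain ⟨n, hn⟩ := n
      induction hn using Submodule.span_induction with
      | mem _ h =>
        obtain ⟨⟨c, j⟩, rfl⟩ := h
        refine ⟨Pi.single j (b * X ^ (c : ℕ)), ?_, ?_⟩
        · rw [hψ, mul_smul, ← hpow c j c.2, ← map_smul, TensorProduct.smul_tmul', smul_eq_mul,
            mul_one]
        · rw [hπs, hg, mul_smul]
      | zero => exact ⟨0, by
          rw [map_zero, show (⟨0, _⟩ : L (d + 1)) = 0 from rfl, TensorProduct.tmul_zero, map_zero],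
          by rw [hg, map_zero, smul_zero]⟩
      | add y z hy hz hy' hz' =>
        obtain ⟨v, hv, hv'⟩ := hy'
        obtain ⟨w, hw, hw'⟩ := hz'
        refine ⟨v + w, ?_, ?_⟩
        · rw [map_add, hv, hw, ← map_add, ← TensorProduct.tmul_add]
          rfl
        · rw [map_add, hv', hw', hg, hg, hg, ← smul_add]
      | smul a y hy hy' =>
        obtain ⟨v, hv, hv'⟩ := hy'
        refine ⟨C a • v, ?_, ?_⟩
        · rw [map_smul, hv, ← map_smul, ← Polynomial.algebraMap_eq, algebraMap_smul,
            ← TensorProduct.tmul_smul]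
          rfl
        · rw [map_smul, hv', hg, hg, ← Polynomial.algebraMap_eq, algebraMap_smul, smul_comm]
    | add y z hy hz =>
      obtain ⟨v, hv, hv'⟩ := hy
      obtain ⟨w, hw, hw'⟩ := hz
      exact ⟨v + w, by rw [map_add, map_add, hv, hw], by rw [map_add, map_add, hv', hw']⟩
  refine ⟨L d, L (d + 1), i, x, hfin _, hfin _, Submodule.inclusion_injective hle, fun m => ?_,
    fun t => ⟨fun ht => ?_, ?_⟩⟩
  · obtain ⟨v, rfl⟩ := hπ m
    refine ⟨∑ j, v j ⊗ₜ ⟨_, hL _ 0 d.succ_pos j⟩, ?_⟩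
    change g _ = _
    rw [map_sum]
    conv_rhs => rw [← Finset.univ_sum_single v, map_sum]
    refine Finset.sum_congr rfl fun j _ => ?_
    rw [hg, hπs]
    simp only [pow_zero, one_smul]
  · obtain ⟨v, hv, hv'⟩ := hlift t
    exact (Submodule.Quotient.mk_eq_zero _).1 (hv.symm.trans (hker v (hv'.trans ht)))
  · rintro ⟨t, rfl⟩
    exact hgf t

/-! ### Induction on the number of variables -/

namespace FreeDimLE

/-- Adjoining a variable raises the bound on the length of resolutions by one. -/
theorem polynomial {A : Type u} [CommRing A] [IsNoetherianRing A] {d : ℕ}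
    (h : ∀ (M : Type u) [AddCommGroup M] [Module A M] [Module.Finite A M], FreeDimLE A d M)
    (M : Type u) [AddCommGroup M] [Module A[X] M] [Module.Finite A[X] M] :
    FreeDimLE A[X] (d + 1) M := by
  let := Module.compHom M (algebraMap A A[X])
  have : IsScalarTower A A[X] M := ⟨fun a b m => by
    rw [Algebra.smul_def, mul_smul]; rfl⟩
  obtain ⟨N', N, i, x, _, _, hi, hsurj, hex⟩ := exists_exact_characteristicMap A M
  exact of_quotient _ _ (characteristicMap_injective i x hi) hsurj hex
    ((h N').baseChange A[X]) ((h N).baseChange A[X])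

theorem mvPolynomial (R : Type u) [CommRing R] [IsDomain R] [IsPrincipalIdealRing R] (n : ℕ)
    (M : Type u) [AddCommGroup M] [Module (MvPolynomial (Fin n) R) M]
    [Module.Finite (MvPolynomial (Fin n) R) M] : FreeDimLE (MvPolynomial (Fin n) R) (n + 1) M := by
  induction n generalizing M with
  | zero =>
    exact of_ringEquiv (MvPolynomial.isEmptyRingEquiv R (Fin 0)).symm
      (fun M _ _ _ => of_isPrincipalIdealRing M) M
  | succ n ih =>
    exact of_ringEquiv (MvPolynomial.finSuccEquiv R n).symm.toRingEquiv
      (fun M _ _ _ => polynomial (fun M _ _ _ => ih M) M) M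

end FreeDimLE

/-! ### From the recursive condition to resolutions -/

namespace FiniteFreeResolution

/-- A finite free module resolves itself. -/
def ofEquiv {S : Type*} [CommRing S] {M : Type*} [AddCommGroup M] [Module S M] {r : ℕ}
    (e : (Fin r → S) ≃ₗ[S] M) : FiniteFreeResolution S M 0 where
  rank i := if i = 0 then r else 0
  rank_eq_zero i hi := if_neg hi.ne'
  d _ := 0
  augmentation := e.toLinearMap
  augmentation_surjective := e.surjective
  exact_zero y := by
    simp only [LinearMap.zero_apply, Set.mem_range, exists_const, LinearEquiv.coe_coe]
    exact e.map_eq_zero_iff.trans eq_comm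
  exact_succ i y := ⟨fun _ => ⟨0, Subsingleton.elim (α := Fin 0 → S) _ _⟩, fun _ => rfl⟩

/-- Splice a resolution of the kernel of a map from a finite free module. -/
def ofKer {S : Type*} [CommRing S] {M : Type*} [AddCommGroup M] [Module S M] {r p : ℕ}
    (f : (Fin r → S) →ₗ[S] M) (hf : Function.Surjective f)
    (F : FiniteFreeResolution S (LinearMap.ker f) p) : FiniteFreeResolution S M (p + 1) where
  rank i := Nat.casesOn i r F.rank
  rank_eq_zero i hi := by
    cases i with
    | zero => omega
    | succ i => exact F.rank_eq_zero i (by omega)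
  d i := match i with
    | 0 => (LinearMap.ker f).subtype ∘ₗ F.augmentation
    | i + 1 => F.d i
  augmentation := f
  augmentation_surjective := hf
  exact_zero y := by
    constructor
    · intro hy
      obtain ⟨z, hz⟩ := F.augmentation_surjective ⟨y, hy⟩
      exact ⟨z, congrArg Subtype.val hz⟩
    · rintro ⟨z, rfl⟩
      exact (F.augmentation z).2
  exact_succ i := match i with
    | 0 => fun y => by
      refine Iff.trans ?_ (F.exact_zero y)
      exact Submodule.coe_eq_zero (x := F.augmentation y)
    | i + 1 => F.exact_succ i

/-- Transport of a resolution along an isomorphism. -/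
def congr {S : Type*} [CommRing S] {M N : Type*} [AddCommGroup M] [Module S M] [AddCommGroup N]
    [Module S N] {p : ℕ} (F : FiniteFreeResolution S M p) (e : M ≃ₗ[S] N) :
    FiniteFreeResolution S N p where
  rank := F.rank
  rank_eq_zero := F.rank_eq_zero
  d := F.d
  augmentation := e.toLinearMap ∘ₗ F.augmentation
  augmentation_surjective := e.surjective.comp F.augmentation_surjective
  exact_zero y := by
    refine Iff.trans ?_ (F.exact_zero y)
    exact e.map_eq_zero_iff
  exact_succ := F.exact_succ

end FiniteFreeResolution

theorem FreeDimLE.nonempty_finiteFreeResolution {S : Type u} [CommRing S] {d : ℕ} {M : Type u}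
    [AddCommGroup M] [Module S M] (h : FreeDimLE S d M) :
    Nonempty (FiniteFreeResolution S M d) := by
  induction d generalizing M with
  | zero =>
    obtain ⟨_, _⟩ := h
    obtain ⟨r, ⟨e⟩⟩ := Module.Free.exists_equiv_fin S M
    exact ⟨.ofEquiv e⟩
  | succ d ih =>
    obtain ⟨r, f, hf, h⟩ := h
    exact (ih h).map (.ofKer f hf)

theorem mainTheorem1 (R : Type*) [CommRing R] [IsDomain R] [IsPrincipalIdealRing R] (n : ℕ)
    (M : Type*) [AddCommGroup M] [Module (MvPolynomial (Fin n) R) M]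
    [Module.Finite (MvPolynomial (Fin n) R) M] :
    ∃ p : ℕ, p ≤ n + 1 ∧ Nonempty (FiniteFreeResolution (MvPolynomial (Fin n) R) M p) := by
  -- `FreeDimLE` needs ring and module in one universe, so `M` is replaced by an isomorphic quotient
  -- of a free module.
  obtain ⟨r, f, hf⟩ := Module.Finite.exists_fin' (MvPolynomial (Fin n) R) M
  obtain ⟨F⟩ := (FreeDimLE.mvPolynomial R n
    ((Fin r → MvPolynomial (Fin n) R) ⧸ LinearMap.ker f)).nonempty_finiteFreeResolution
  exact ⟨n + 1, le_rfl, ⟨F.congr (f.quotKerEquivOfSurjective hf)⟩⟩
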